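/- Let $p$ be a prime, let $A\in\mathrm{SL}(2,\mathbb{Z})$, and let $$M(A)=\big(\mathbb{R}^2/\mathbb{Z}^2\times[0,1]\big)\big/\big((x,0)\sim(Ax,1)\big)$$ be the mapping torus of the automorphism $x\mapsto Ax$ of the torus $\mathbb{R}^2/\mathbb{Z}^2$. Let $$Z(M(A),\mathbb{Z}/p)=\frac{|\mathrm{Hom}(\pi_1(M(A)),\mathbb{Z}/p)|}{p}$$ be its untwisted $\mathbb{Z}/p$ Dijkgraaf-Witten invariant (computed at any base point). Then $$Z(M(A),\mathbb{Z}/p)=\begin{cases}p^2 & \text{if } A\equiv \mathrm{Id} \bmod p,\\ p & \text{if } A\not\equiv \mathrm{Id} \bmod p \text{ and } \operatorname{Tr}(A)\equiv 2 \bmod p,\\ 1 & \text{otherwise.}\end{cases}$$ Moreover, if $\mathrm{diag}(a_1,a_2)$ is the Smith normal form of $A-\mathrm{Id}$ over $\mathbb{Z}$ (that is, $P(A-\mathrm{Id})Q=\mathrm{diag}(a_1,a_2)$ for some $P,Q\in\mathrm{GL}(2,\mathbb{Z})$, with $a_1,a_2\ge 0$ and $a_1\mid a_2$), then $Z(M(A),\mathbb{Z}/p)=p^{k}$,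 where $k$ is the number of $i\in\{1,2\}$ such that $p\mid a_i$ (zero entries are counted, since $p\mid 0$). -/

import Mathlib

/-- The mapping torus `M(f) = S × [0,1] / ((x, 0) ~ (f x, 1))` of a self-homeomorphism `f` of `S`;
as a `Quot` of the product space it carries the quotient topology. -/
def MappingTorus {S : Type*} [TopologicalSpace S] (f : S ≃ₜ S) : Type _ :=
  Quot (fun a b : S × unitInterval => a.2 = 0 ∧ b = (f a.1, 1))

instance instTopologicalSpaceMappingTorus {S : Type*} [TopologicalSpace S] (f : S ≃ₜ S) : TopologicalSpace (MappingTorus f) :=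
  inferInstanceAs (TopologicalSpace (Quot _))

/-- The two-dimensional torus `ℝ² / ℤ²`, written as `(ℝ / ℤ)²`. -/
abbrev Torus : Type := Fin 2 → UnitAddCircle

/-- Multiplication of a point of `(ℝ / ℤ)²` by an integer matrix. -/
def torusMul (B : Matrix (Fin 2) (Fin 2) ℤ) (x : Torus) : Torus :=
  fun i => ∑ j, B i j • x j

theorem torusMul_torusMul (B C : Matrix (Fin 2) (Fin 2) ℤ) (x : Torus) :
    torusMul B (torusMul C x) = torusMul (B * C) x := by
  funext i
  simp only [torusMul, Matrix.mul_apply, Fin.sum_univ_two, smul_add, add_smul, mul_smul]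
  abel

theorem torusMul_one (x : Torus) : torusMul 1 x = x := by
  funext i
  simp [torusMul, Matrix.one_apply, ite_smul]

theorem continuous_torusMul (B : Matrix (Fin 2) (Fin 2) ℤ) : Continuous (torusMul B) := by
  unfold torusMul
  fun_prop

/-- The linear automorphism `x ↦ A x` of the torus `ℝ² / ℤ²` given by `A ∈ SL(2, ℤ)`; it represents
the mapping class corresponding to `A`. -/
def torusHomeo (A : Matrix.SpecialLinearGroup (Fin 2) ℤ) : Torus ≃ₜ Torus where
  toFun := torusMul (A : Matrix (Fin 2) (Fin 2) ℤ)
  invFun := torusMul ((A⁻¹ : Matrix.SpecialLinearGroup (Fin 2) ℤ) : Matrix (Fin 2) (Fin 2) ℤ)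
  left_inv x := by
    rw [torusMul_torusMul, ← Matrix.SpecialLinearGroup.coe_mul, inv_mul_cancel,
      Matrix.SpecialLinearGroup.coe_one, torusMul_one]
  right_inv x := by
    rw [torusMul_torusMul, ← Matrix.SpecialLinearGroup.coe_mul, mul_inv_cancel,
      Matrix.SpecialLinearGroup.coe_one, torusMul_one]
  continuous_toFun := continuous_torusMul _
  continuous_invFun := continuous_torusMul _

/-- The untwisted Dijkgraaf-Witten invariant `|Hom(π₁(M, x), G)| / |G|`, for `G` a finite group. -/
noncomputable def untwistedDW (M : Type*) [TopologicalSpace M] (x : M) (G : Type*) [Group G] : ℚ :=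
  (Nat.card (FundamentalGroup M x →* G) : ℚ) / (Nat.card G : ℚ)

/-- `diag(a 0, …, a (n-1))` is the Smith normal form of the integer matrix `B`. As `0` divides only
`0`, the zero entries come last. -/
def IsSmithNormalForm {n : ℕ} (B : Matrix (Fin n) (Fin n) ℤ) (a : Fin n → ℤ) : Prop :=
  (∃ P Q : Matrix.GeneralLinearGroup (Fin n) ℤ,
    (P : Matrix (Fin n) (Fin n) ℤ) * B * (Q : Matrix (Fin n) (Fin n) ℤ) = Matrix.diagonal a) ∧
  (∀ i, 0 ≤ a i) ∧ ∀ i j, i ≤ j → a i ∣ a j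

/-!
The fundamental group of the mapping torus `M(A)` is `ℤ² ⋊ ℤ`, with the generator of `ℤ` acting on
`ℤ²` by `A`. To see this, let that group act on `ℝ² × ℝ` by `(v, n) • (y, t) = (Aⁿ y + v, t + n)`.
The map `(y, t) ↦ [A⁻ⁿ y, t - n]`, `n = ⌊t⌋`, is continuous because the gluing relation
`(x, 0) ~ (A x, 1)` reconciles the formulas on adjacent strips `n ≤ t ≤ n + 1`; it is a quotient
map, its fibres are the orbits, and no nontrivial element moves a point by less than `1`. It is
thus a quotient covering map with contractible total space
(`MappingTorus.isQuotientCoveringMap_cover`), so `π₁` is the (opposite of the) deck group.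

A homomorphism from `ℤ² ⋊ ℤ` to `ℤ / p` is a linear form on `ℤ²` fixed by `A`, together with a free
value on the generator of `ℤ` (`TorusBundleGroup.homEquiv`). The invariant forms are the kernel of
the transpose of `A - 1` modulo `p`, whence `Z(M(A), ℤ / p) = p ^ (2 - rank (A - 1 mod p))`
(`untwistedDW_mappingTorus`). All the cases are read off from this rank: since `det A = 1`,
`det (A - 1) = 2 - Tr A`, and multiplication by `P, Q ∈ GL(2, ℤ)` does not change the rank.
-/

/-! ### The group `ℤ² ⋊ ℤ` -/

/-- The action of `SL(2, ℤ)` on `M²`, for an abelian group `M`, by `(B v) i = ∑ j, B i j • v j`.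
With `M = ℝ / ℤ` this is `torusMul`. -/
@[reducible]
def slDistribMulAction (M : Type*) [AddCommGroup M] :
    DistribMulAction (Matrix.SpecialLinearGroup (Fin 2) ℤ) (Fin 2 → M) where
  smul B v i := ∑ j, (B : Matrix (Fin 2) (Fin 2) ℤ) i j • v j
  one_smul v := by
    change (fun i => ∑ j, (1 : Matrix (Fin 2) (Fin 2) ℤ) i j • v j) = v
    funext i
    simp [Matrix.one_apply, ite_smul]
  mul_smul B C v := by
    change (fun i => ∑ j, (B.1 * C.1 : Matrix (Fin 2) (Fin 2) ℤ) i j • v j) =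
      fun i => ∑ j, B.1 i j • ∑ k, C.1 j k • v k
    funext i
    simp only [Matrix.mul_apply, Fin.sum_univ_two, smul_add, add_smul, mul_smul]
    abel
  smul_zero B := by
    change (fun i => ∑ j, B.1 i j • (0 : M)) = 0
    funext i
    simp
  smul_add B v w := by
    change (fun i => ∑ j, B.1 i j • (v j + w j)) =
      (fun i => ∑ j, B.1 i j • v j) + fun i => ∑ j, B.1 i j • w j
    funext i
    simp [smul_add, Finset.sum_add_distrib]

attribute [local instance] slDistribMulAction

theorem sl_smul_apply {M : Type*} [AddCommGroup M] (B : Matrix.SpecialLinearGroup (Fin 2) ℤ)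
    (v : Fin 2 → M) (i : Fin 2) :
    (B • v) i = ∑ j, (B : Matrix (Fin 2) (Fin 2) ℤ) i j • v j := rfl

theorem torusHomeo_apply (A : Matrix.SpecialLinearGroup (Fin 2) ℤ) (x : Torus) :
    torusHomeo A x = A • x := rfl

theorem sl_smul_map {M N : Type*} [AddCommGroup M] [AddCommGroup N] (f : M →+ N)
    (B : Matrix.SpecialLinearGroup (Fin 2) ℤ) (v : Fin 2 → M) :
    (fun i => f ((B • v) i)) = B • fun i => f (v i) := by
  funext i
  simp [sl_smul_apply]

theorem continuous_sl_smul {M : Type*} [AddCommGroup M] [TopologicalSpace M]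
    [IsTopologicalAddGroup M] (B : Matrix.SpecialLinearGroup (Fin 2) ℤ) :
    Continuous fun v : Fin 2 → M => B • v :=
  continuous_pi fun i => by
    simp only [sl_smul_apply]
    fun_prop

/-- The semidirect product `ℤ² ⋊ ℤ` in which the generator of `ℤ` acts on `ℤ²` by `A`. The pair
`(v, n)` stands for the affine map `(y, t) ↦ (Aⁿ y + v, t + n)` of `ℝ² × ℝ`. -/
@[ext]
structure TorusBundleGroup (A : Matrix.SpecialLinearGroup (Fin 2) ℤ) where
  /-- The component in the normal subgroup `ℤ²`. -/
  vec : Fin 2 → ℤ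
  /-- The component in the quotient `ℤ`. -/
  shift : ℤ

namespace TorusBundleGroup

variable {A : Matrix.SpecialLinearGroup (Fin 2) ℤ}

instance : Mul (TorusBundleGroup A) := ⟨fun g h => ⟨g.vec + A ^ g.shift • h.vec, g.shift + h.shift⟩⟩

instance : One (TorusBundleGroup A) := ⟨⟨0, 0⟩⟩

instance : Inv (TorusBundleGroup A) := ⟨fun g => ⟨-(A ^ (-g.shift) • g.vec), -g.shift⟩⟩

@[simp] theorem mul_vec (g h : TorusBundleGroup A) :
    (g * h).vec = g.vec + A ^ g.shift • h.vec := rfl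

@[simp] theorem mul_shift (g h : TorusBundleGroup A) : (g * h).shift = g.shift + h.shift := rfl

@[simp] theorem one_vec : (1 : TorusBundleGroup A).vec = 0 := rfl

@[simp] theorem one_shift : (1 : TorusBundleGroup A).shift = 0 := rfl

@[simp] theorem inv_vec (g : TorusBundleGroup A) : (g⁻¹).vec = -(A ^ (-g.shift) • g.vec) := rfl

@[simp] theorem inv_shift (g : TorusBundleGroup A) : (g⁻¹).shift = -g.shift := rfl

instance : Group (TorusBundleGroup A) :=
  Group.ofLeftAxioms
    (fun g h k => by
      ext1
      · simp [zpow_add, mul_smul, smul_add, add_assoc]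
      · simp [add_assoc])
    (fun g => by ext1 <;> simp)
    (fun g => by ext1 <;> simp)

/-- The inclusion of the normal subgroup `ℤ²`. -/
def translation : Multiplicative (Fin 2 → ℤ) →* TorusBundleGroup A where
  toFun v := ⟨v.toAdd, 0⟩
  map_one' := rfl
  map_mul' v w := by ext1 <;> simp

/-- The splitting `ℤ → ℤ² ⋊ ℤ`. -/
def lift : Multiplicative ℤ →* TorusBundleGroup A where
  toFun n := ⟨0, n.toAdd⟩
  map_one' := rfl
  map_mul' v w := by ext1 <;> simp

theorem eq_translation_mul_lift (g : TorusBundleGroup A) :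
    g = translation (.ofAdd g.vec) * lift (.ofAdd g.shift) := by
  ext1 <;> simp [translation, lift]

theorem lift_mul_translation (v : Fin 2 → ℤ) :
    lift (.ofAdd 1) * translation (.ofAdd v) =
      (translation (.ofAdd (A • v)) * lift (.ofAdd 1) : TorusBundleGroup A) := by
  ext1 <;> simp [translation, lift]

/-! ### The action on `ℝ² × ℝ` -/

/-- `ℤ² ⋊ ℤ` acts on `ℝ² × ℝ` by `(v, n) • (y, t) = (Aⁿ y + v, t + n)`. -/
instance : MulAction (TorusBundleGroup A) ((Fin 2 → ℝ) × ℝ) where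
  smul g e := (A ^ g.shift • e.1 + fun i => (g.vec i : ℝ), e.2 + g.shift)
  one_smul e := by
    change (A ^ (0 : ℤ) • e.1 + fun i => (((0 : Fin 2 → ℤ) i : ℤ) : ℝ), e.2 + ((0 : ℤ) : ℝ)) = e
    ext <;> simp
  mul_smul g h e := by
    have key := sl_smul_map (Int.castAddHom ℝ) (A ^ g.shift) h.vec
    simp only [Int.coe_castAddHom] at key
    refine Prod.ext ?_ ?_
    · change A ^ (g.shift + h.shift) • e.1 + (fun i => ((g.vec + A ^ g.shift • h.vec) i : ℝ)) =
        A ^ g.shift • (A ^ h.shift • e.1 + fun i => (h.vec i : ℝ)) + fun i => (g.vec i : ℝ)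
      rw [smul_add, ← key, zpow_add, mul_smul]
      funext i
      simp only [Pi.add_apply, Int.cast_add]
      ring
    · change e.2 + ((g.shift + h.shift : ℤ) : ℝ) = e.2 + h.shift + g.shift
      push_cast
      ring

theorem smul_def (g : TorusBundleGroup A) (e : (Fin 2 → ℝ) × ℝ) :
    g • e = (A ^ g.shift • e.1 + fun i => (g.vec i : ℝ), e.2 + g.shift) := rfl

instance : ContinuousConstSMul (TorusBundleGroup A) ((Fin 2 → ℝ) × ℝ) where
  continuous_const_smul g := by
    simp only [smul_def]
    exact (((continuous_sl_smul _).comp continuous_fst).add continuous_const).prodMk (by fun_prop)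

/-- A group element that moves some point by less than `1` in the sup distance is trivial: its
integral shift vanishes, and then so does its integral translation vector. -/
theorem eq_one_of_dist_smul_lt (g : TorusBundleGroup A) (e : (Fin 2 → ℝ) × ℝ)
    (h : dist (g • e) e < 1) : g = 1 := by
  rw [smul_def, Prod.dist_eq, max_lt_iff] at h
  obtain ⟨h₁, h₂⟩ := h
  have hs : g.shift = 0 := by
    rw [Real.dist_eq, add_sub_cancel_left] at h₂
    exact Int.abs_lt_one_iff.mp (by exact_mod_cast h₂)
  ext i
  · rw [dist_pi_lt_iff one_pos] at h₁
    have := h₁ i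
    simp only [hs, zpow_zero, one_smul, Pi.add_apply, Real.dist_eq, add_sub_cancel_left] at this
    exact Int.abs_lt_one_iff.mp (by exact_mod_cast this)
  · exact hs

end TorusBundleGroup

/-! ### The universal covering of the mapping torus -/

namespace MappingTorus

variable {A : Matrix.SpecialLinearGroup (Fin 2) ℤ}

/-- The quotient map `ℝ² → ℝ² / ℤ²`. -/
def torusMk (y : Fin 2 → ℝ) : Torus := fun i => (y i : UnitAddCircle)

theorem isOpenQuotientMap_torusMk : IsOpenQuotientMap torusMk :=
  IsOpenQuotientMap.piMap fun _ => QuotientAddGroup.isOpenQuotientMap_mk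

theorem torusMk_smul (B : Matrix.SpecialLinearGroup (Fin 2) ℤ) (y : Fin 2 → ℝ) :
    torusMk (B • y) = B • torusMk y :=
  sl_smul_map (QuotientAddGroup.mk' (AddSubgroup.zmultiples (1 : ℝ))) B y

theorem torusMk_add_intCast (y : Fin 2 → ℝ) (v : Fin 2 → ℤ) :
    torusMk (y + fun i => (v i : ℝ)) = torusMk y := by
  funext i
  simp [torusMk]

theorem exists_intCast_of_torusMk_eq {y z : Fin 2 → ℝ} (h : torusMk y = torusMk z) :
    ∃ v : Fin 2 → ℤ, y = z + fun i => (v i : ℝ) := by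
  have (i : Fin 2) : ∃ n : ℤ, n • (1 : ℝ) = y i - z i :=
    (AddCircle.coe_eq_zero_iff _).mp <| by
      rw [AddCircle.coe_sub, sub_eq_zero]
      exact congrFun h i
  choose v hv using this
  refine ⟨v, funext fun i => ?_⟩
  have := hv i
  simp only [zsmul_eq_mul, mul_one] at this
  simp [this]

/-- The class in the mapping torus of a point of `ℝ² / ℤ² × [0, 1]`. -/
def mk (a : Torus × unitInterval) : MappingTorus (torusHomeo A) := Quot.mk _ a

theorem isQuotientMap_mk : Topology.IsQuotientMap (mk (A := A)) := isQuotientMap_quot_mk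

theorem mk_zero (x : Torus) : mk (A := A) (x, 0) = mk (A • x, 1) := Quot.sound ⟨rfl, rfl⟩

/-- The universal covering `ℝ² × ℝ → M(A)`, `(y, t) ↦ [A⁻ⁿ y, t - n]` for `n = ⌊t⌋`. -/
noncomputable def cover (A : Matrix.SpecialLinearGroup (Fin 2) ℤ) (e : (Fin 2 → ℝ) × ℝ) :
    MappingTorus (torusHomeo A) :=
  mk (torusMk (A ^ (-⌊e.2⌋) • e.1), ⟨Int.fract e.2, Int.fract_nonneg _, (Int.fract_lt_one _).le⟩)

/-- The formula defining `cover` holds on the whole closed strip `n ≤ t ≤ n + 1`, because of the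
gluing relation at `t = n + 1`. -/
theorem cover_eq_of_mem_Icc {e : (Fin 2 → ℝ) × ℝ} {n : ℤ} (h : e.2 ∈ Set.Icc (n : ℝ) (n + 1)) :
    cover A e = mk (torusMk (A ^ (-n) • e.1), Set.projIcc 0 1 zero_le_one (e.2 - n)) := by
  have hmem : e.2 - n ∈ Set.Icc (0 : ℝ) 1 := ⟨by linarith [h.1], by linarith [h.2]⟩
  rw [Set.projIcc_of_mem _ hmem]
  rcases h.2.lt_or_eq with hlt | heq
  · have hn : ⌊e.2⌋ = n := Int.floor_eq_iff.mpr ⟨h.1, hlt⟩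
    simp only [cover, Int.fract, hn]
  · have hn : ⌊e.2⌋ = n + 1 := Int.floor_eq_iff.mpr ⟨by push_cast; linarith, by push_cast; linarith⟩
    have hpow : A ^ (-n) = A * A ^ (-(n + 1)) := by
      rw [← zpow_one_add]
      congr 1
      ring
    have h0 : (⟨Int.fract e.2, Int.fract_nonneg _, (Int.fract_lt_one _).le⟩ : unitInterval) = 0 :=
      Subtype.ext (by simp [Int.fract, heq])
    have h1 : (⟨e.2 - n, hmem⟩ : unitInterval) = 1 := Subtype.ext (by simp [heq])
    rw [cover, h0, h1, mk_zero, hn, hpow, mul_smul A, torusMk_smul A]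

theorem continuous_cover : Continuous (cover A) := by
  have hfin : LocallyFinite fun n : ℤ => Prod.snd (α := Fin 2 → ℝ) ⁻¹' Set.Icc (n : ℝ) (n + 1) :=
    (locallyFinite_Icc_of_tendsto tendsto_intCast_atTop_atTop
      (Filter.tendsto_atBot_add_const_right _ _
        (tendsto_intCast_atBot_iff.mpr Filter.tendsto_id))).preimage_continuous continuous_snd
  refine hfin.continuous (Set.eq_univ_of_forall fun e => Set.mem_iUnion.mpr ⟨⌊e.2⌋,
    Int.floor_le _, (Int.lt_floor_add_one _).le⟩) (fun n => isClosed_Icc.preimage continuous_snd)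
    fun n => ContinuousOn.congr (Continuous.continuousOn ?_) fun e he => cover_eq_of_mem_Icc he
  exact isQuotientMap_mk.continuous.comp
    ((isOpenQuotientMap_torusMk.continuous.comp
      ((continuous_sl_smul _).comp continuous_fst)).prodMk
        (continuous_projIcc.comp (continuous_snd.sub continuous_const)))

theorem cover_coe (y : Fin 2 → ℝ) (s : unitInterval) : cover A (y, s) = mk (torusMk y, s) := by
  have := cover_eq_of_mem_Icc (A := A) (e := (y, s)) (n := 0) (by simp)
  simpa using this

/-- The restriction of `cover` to `ℝ² × [0, 1]` is already a quotient map. -/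
theorem isQuotientMap_cover : Topology.IsQuotientMap (cover A) := by
  refine .of_comp (f := Prod.map id ((↑) : unitInterval → ℝ)) (by fun_prop) continuous_cover ?_
  convert! isQuotientMap_mk.comp (isOpenQuotientMap_torusMk.prodMap
    (IsOpenQuotientMap.id (X := unitInterval))).isQuotientMap using 1
  funext e
  exact cover_coe e.1 e.2

theorem cover_smul (g : TorusBundleGroup A) (e : (Fin 2 → ℝ) × ℝ) :
    cover A (g • e) = cover A e := by
  have hpow : A ^ (-⌊e.2 + g.shift⌋) • A ^ g.shift • e.1 = A ^ (-⌊e.2⌋) • e.1 := by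
    rw [smul_smul, ← zpow_add, Int.floor_add_intCast]
    congr 2
    ring
  have key := sl_smul_map (Int.castAddHom ℝ) (A ^ (-⌊e.2 + g.shift⌋)) g.vec
  simp only [Int.coe_castAddHom] at key
  simp only [cover, TorusBundleGroup.smul_def, smul_add, ← key, torusMk_add_intCast, hpow,
    Int.fract_add_intCast]

/-- The map from the mapping torus back to the orbit space of `ℝ² × ℝ`; it sends the class of
`(x, s)` to the orbit of `(y, s)`, for a chosen representative `y` of `x`. -/
noncomputable def toOrbit : MappingTorus (torusHomeo A) →
    MulAction.orbitRel.Quotient (TorusBundleGroup A) ((Fin 2 → ℝ) × ℝ) :=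
  Quot.lift (fun a => Quotient.mk _ (Function.surjInv isOpenQuotientMap_torusMk.surjective a.1, a.2))
    (by
      rintro ⟨x, s⟩ _ ⟨rfl, rfl⟩
      set r := Function.surjInv isOpenQuotientMap_torusMk.surjective
      have hr (x : Torus) : torusMk (r x) = x := Function.surjInv_eq _ x
      obtain ⟨v, hv⟩ := exists_intCast_of_torusMk_eq (y := r (A • x)) (z := A • r x)
        (by rw [torusMk_smul, hr, hr])
      -- The chosen lifts of `(x, 0)` and `(A x, 1)` differ by the generator of `ℤ` and a translation.
      refine (Quotient.sound (s := MulAction.orbitRel _ _)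
        (show _ ∈ MulAction.orbit _ _ from ⟨⟨v, 1⟩, ?_⟩)).symm
      ext <;> simp [TorusBundleGroup.smul_def, torusHomeo_apply, hv])

theorem toOrbit_cover (e : (Fin 2 → ℝ) × ℝ) : toOrbit (cover A e) = Quotient.mk _ e := by
  set r := Function.surjInv isOpenQuotientMap_torusMk.surjective
  have hr (x : Torus) : torusMk (r x) = x := Function.surjInv_eq _ x
  obtain ⟨v, hv⟩ := exists_intCast_of_torusMk_eq (hr (torusMk (A ^ (-⌊e.2⌋) • e.1)))
  refine Quotient.sound ⟨⟨v, -⌊e.2⌋⟩, Prod.ext hv.symm ?_⟩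
  simp [TorusBundleGroup.smul_def, Int.fract, sub_eq_add_neg]

theorem isQuotientCoveringMap_cover : IsQuotientCoveringMap (cover A) (TorusBundleGroup A) where
  __ := isQuotientMap_cover
  continuous_const_smul := continuous_const_smul
  apply_eq_iff_mem_orbit {e₁ e₂} := by
    refine ⟨fun h => ?_, ?_⟩
    · have := congrArg toOrbit h
      rw [toOrbit_cover, toOrbit_cover] at this
      exact Quotient.exact this
    · rintro ⟨g, rfl⟩
      exact cover_smul g e₂
  disjoint e := by
    -- The ball has diameter at most `1`, the least distance a nontrivial element moves a point.
    refine ⟨Metric.ball e (1 / 2), Metric.ball_mem_nhds _ (by norm_num), fun g hg => ?_⟩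
    obtain ⟨_, ⟨e', he', rfl⟩, hge'⟩ := hg
    refine g.eq_one_of_dist_smul_lt e' ((dist_triangle_right _ _ e).trans_lt ?_)
    linarith [Metric.mem_ball.mp he', Metric.mem_ball.mp hge']

theorem nonempty_fundamentalGroup_mulEquiv (x : MappingTorus (torusHomeo A)) :
    Nonempty (FundamentalGroup (MappingTorus (torusHomeo A)) x ≃* (TorusBundleGroup A)ᵐᵒᵖ) := by
  obtain ⟨e, he⟩ := isQuotientMap_cover.surjective x
  exact ⟨isQuotientCoveringMap_cover.fundamentalGroupEquiv ⟨e, he⟩⟩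

end MappingTorus
/-! ### Counting homomorphisms to `ℤ / p` -/

section Counting

open Matrix

/-- The integer matrix `A - 1` reduced modulo `p`. -/
def subOneMod (p : ℕ) (A : SpecialLinearGroup (Fin 2) ℤ) : Matrix (Fin 2) (Fin 2) (ZMod p) :=
  ((A : Matrix (Fin 2) (Fin 2) ℤ) - 1).map (Int.cast : ℤ → ZMod p)

theorem subOneMod_eq (p : ℕ) (A : SpecialLinearGroup (Fin 2) ℤ) :
    subOneMod p A = (A : Matrix (Fin 2) (Fin 2) ℤ).map (Int.cast : ℤ → ZMod p) - 1 := by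
  rw [subOneMod, Matrix.map_sub _ (fun a b => Int.cast_sub a b),
    Matrix.map_one _ Int.cast_zero Int.cast_one]

/-- The linear form on `ℤ²` with values in `ℤ / p` and coefficients `c`. -/
def zmodForm {p : ℕ} (c : Fin 2 → ZMod p) : (Fin 2 → ℤ) →+ ZMod p where
  toFun v := ∑ i, c i * v i
  map_zero' := by simp
  map_add' v w := by simp [mul_add, Finset.sum_add_distrib]

theorem zmodForm_apply {p : ℕ} (c : Fin 2 → ZMod p) (v : Fin 2 → ℤ) :
    zmodForm c v = ∑ i, c i * v i := rfl

theorem zmodForm_smul {p : ℕ} {A : SpecialLinearGroup (Fin 2) ℤ} {c : Fin 2 → ZMod p} :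
    (∀ v, zmodForm c (A • v) = zmodForm c v) ↔ (subOneMod p A)ᵀ *ᵥ c = 0 := by
  have key (v : Fin 2 → ℤ) :
      zmodForm c (A • v) - zmodForm c v = zmodForm ((subOneMod p A)ᵀ *ᵥ c) v := by
    simp [zmodForm_apply, sl_smul_apply, subOneMod_eq, Fin.sum_univ_two]
    ring
  refine ⟨fun h => funext fun i => ?_, fun h v => ?_⟩
  · have := key (Pi.single i 1)
    rw [h, sub_self] at this
    simpa [zmodForm_apply, Pi.single_apply, ite_mul] using this.symm
  · rw [← sub_eq_zero, key, h]
    simp [zmodForm_apply]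

/-- A linear form fixed by `A` is fixed by every power of `A`. -/
theorem zmodForm_zpow_smul {p : ℕ} {A : SpecialLinearGroup (Fin 2) ℤ} {c : Fin 2 → ZMod p}
    (h : ∀ v, zmodForm c (A • v) = zmodForm c v) (n : ℤ) (v : Fin 2 → ℤ) :
    zmodForm c (A ^ n • v) = zmodForm c v := by
  induction n generalizing v with
  | zero => simp
  | succ n ih => rw [_root_.zpow_add_one, mul_smul, ih, h]
  | pred n ih => rw [_root_.zpow_sub_one, mul_smul, ih, ← h, smul_inv_smul]

theorem eq_zmodForm {p : ℕ} (f : (Fin 2 → ℤ) →+ ZMod p) (v : Fin 2 → ℤ) :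
    f v = zmodForm (fun i => f (Pi.single i 1)) v := by
  have hv : v = v 0 • Pi.single 0 (1 : ℤ) + v 1 • Pi.single 1 (1 : ℤ) := by
    ext i
    fin_cases i <;> simp
  conv_lhs => rw [hv, map_add, map_zsmul, map_zsmul]
  simp [zmodForm_apply, mul_comm]

namespace TorusBundleGroup

variable {p : ℕ} {A : SpecialLinearGroup (Fin 2) ℤ}

/-- The restriction to `ℤ²` of a homomorphism `ℤ² ⋊ ℤ → ℤ / p`, in additive notation. -/
def homForm (φ : TorusBundleGroup A →* Multiplicative (ZMod p)) : (Fin 2 → ℤ) →+ ZMod p :=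
  MonoidHom.toAdditive (φ.comp translation)

theorem ofAdd_homForm (φ : TorusBundleGroup A →* Multiplicative (ZMod p)) (v : Fin 2 → ℤ) :
    Multiplicative.ofAdd (homForm φ v) = φ (translation (.ofAdd v)) := rfl

/-- Conjugation by the generator of `ℤ` becomes invisible in an abelian group. -/
theorem homForm_smul (φ : TorusBundleGroup A →* Multiplicative (ZMod p)) (v : Fin 2 → ℤ) :
    homForm φ (A • v) = homForm φ v := by
  have h := congrArg φ (lift_mul_translation (A := A) v)
  rw [map_mul, map_mul, mul_comm] at h
  have h' : φ (translation (.ofAdd v)) = φ (translation (.ofAdd (A • v))) := mul_right_cancel h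
  exact congrArg Multiplicative.toAdd h'.symm

/-- The homomorphism `(v, n) ↦ c · v + n d` given by an `A`-invariant linear form `c`. -/
def homOfForm (c : Fin 2 → ZMod p) (hc : ∀ v, zmodForm c (A • v) = zmodForm c v) (d : ZMod p) :
    TorusBundleGroup A →* Multiplicative (ZMod p) where
  toFun g := .ofAdd (zmodForm c g.vec + g.shift * d)
  map_one' := by simp
  map_mul' g h := by
    rw [mul_vec, mul_shift, map_add (zmodForm c), zmodForm_zpow_smul hc, ← ofAdd_add, Int.cast_add]
    congr 1
    ring

theorem homOfForm_apply (c : Fin 2 → ZMod p) (hc : ∀ v, zmodForm c (A • v) = zmodForm c v)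
    (d : ZMod p) (g : TorusBundleGroup A) :
    homOfForm c hc d g = .ofAdd (zmodForm c g.vec + g.shift * d) := rfl

/-- A homomorphism `ℤ² ⋊ ℤ → ℤ / p` is an `A`-invariant linear form on `ℤ²` together with an
arbitrary value on the generator of `ℤ`. -/
def homEquiv (p : ℕ) (A : SpecialLinearGroup (Fin 2) ℤ) :
    (TorusBundleGroup A →* Multiplicative (ZMod p)) ≃
      LinearMap.ker (subOneMod p A)ᵀ.mulVecLin × ZMod p where
  toFun φ :=
    (⟨fun i => homForm φ (Pi.single i 1), by
      rw [LinearMap.mem_ker, mulVecLin_apply, ← zmodForm_smul]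
      intro v
      rw [← eq_zmodForm (homForm φ), ← eq_zmodForm (homForm φ), homForm_smul]⟩,
    (φ (lift (.ofAdd 1))).toAdd)
  invFun c := homOfForm c.1.1 (zmodForm_smul.mpr c.1.2) c.2
  left_inv φ := by
    refine MonoidHom.ext fun g => ?_
    have hs : (Multiplicative.ofAdd g.shift) = (Multiplicative.ofAdd 1) ^ g.shift := by
      rw [← ofAdd_zsmul, smul_eq_mul, mul_one]
    conv_rhs => rw [eq_translation_mul_lift g, map_mul, ← ofAdd_homForm, hs, map_zpow, map_zpow]
    rw [homOfForm_apply, ← eq_zmodForm, ofAdd_add, ← zsmul_eq_mul, ofAdd_zsmul, ofAdd_toAdd]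
  right_inv c := by
    have hc : ∀ v, zmodForm c.1.1 (A • v) = zmodForm c.1.1 v := zmodForm_smul.mpr c.1.2
    refine Prod.ext (Subtype.ext (funext fun i => ?_)) ?_
    · apply Multiplicative.ofAdd.injective
      change homOfForm c.1.1 hc c.2 (translation (.ofAdd (Pi.single i 1))) = _
      simp [homOfForm_apply, zmodForm_apply, translation, Pi.single_apply]
    · apply Multiplicative.ofAdd.injective
      change homOfForm c.1.1 hc c.2 (lift (.ofAdd 1)) = _
      simp [homOfForm_apply, lift]

end TorusBundleGroup

/-- The Dijkgraaf-Witten invariant counts the `A`-invariant linear forms `ℤ² → ℤ / p`; the factor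
`p` coming from the base circle cancels the denominator. -/
theorem untwistedDW_mappingTorus {p : ℕ} [Fact p.Prime] (A : SpecialLinearGroup (Fin 2) ℤ)
    (x : MappingTorus (torusHomeo A)) :
    untwistedDW (MappingTorus (torusHomeo A)) x (Multiplicative (ZMod p)) =
      (p : ℚ) ^ (2 - (subOneMod p A).rank) := by
  obtain ⟨e⟩ := MappingTorus.nonempty_fundamentalGroup_mulEquiv x
  have hcard : Nat.card (FundamentalGroup (MappingTorus (torusHomeo A)) x →*
      Multiplicative (ZMod p)) = p ^ (2 - (subOneMod p A).rank) * p := by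
    -- An anti-homomorphism into a commutative group is a homomorphism.
    have e' : FundamentalGroup (MappingTorus (torusHomeo A)) x ≃* TorusBundleGroup A :=
      e.trans (MulEquiv.inv' _).symm
    rw [Nat.card_congr (e'.monoidHomCongrLeftEquiv.trans (TorusBundleGroup.homEquiv p A)),
      Nat.card_prod, Nat.card_zmod, Module.natCard_eq_pow_finrank (K := ZMod p), Nat.card_zmod]
    have := LinearMap.finrank_range_add_finrank_ker (subOneMod p A)ᵀ.mulVecLin
    rw [← Matrix.rank, rank_transpose, Module.finrank_fin_fun] at this
    rw [← Nat.eq_sub_of_add_eq' this]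
  have hp : (p : ℚ) ≠ 0 := Nat.cast_ne_zero.mpr (Fact.out : p.Prime).ne_zero
  have hc : Nat.card (Multiplicative (ZMod p)) = p := Nat.card_zmod p
  rw [untwistedDW, hcard, hc, Nat.cast_mul, Nat.cast_pow, mul_div_cancel_right₀ _ hp]

/-! ### The rank of `A - 1` modulo `p` -/

theorem det_subOneMod (p : ℕ) (A : SpecialLinearGroup (Fin 2) ℤ) :
    (subOneMod p A).det = ((2 - (A : Matrix (Fin 2) (Fin 2) ℤ).trace : ℤ) : ZMod p) := by
  have hdet := A.det_coe
  rw [det_fin_two] at hdet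
  have : ((A : Matrix (Fin 2) (Fin 2) ℤ) - 1).det = 2 - (A : Matrix (Fin 2) (Fin 2) ℤ).trace := by
    rw [det_fin_two, trace_fin_two]
    simp
    linarith
  rw [← this]
  exact (RingHom.map_det (Int.castRingHom (ZMod p)) _).symm

theorem subOneMod_eq_zero_iff {p : ℕ} {A : SpecialLinearGroup (Fin 2) ℤ} :
    subOneMod p A = 0 ↔ (A : Matrix (Fin 2) (Fin 2) ℤ).map (Int.cast : ℤ → ZMod p) = 1 := by
  rw [subOneMod_eq, sub_eq_zero]

theorem det_subOneMod_eq_zero_iff {p : ℕ} {A : SpecialLinearGroup (Fin 2) ℤ} :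
    (subOneMod p A).det = 0 ↔ (A : Matrix (Fin 2) (Fin 2) ℤ).trace ≡ 2 [ZMOD p] := by
  rw [det_subOneMod, ZMod.intCast_zmod_eq_zero_iff_dvd, Int.modEq_iff_dvd]

theorem rank_eq_one_of_ne_zero_of_det_eq_zero {K : Type*} [Field K] {B : Matrix (Fin 2) (Fin 2) K}
    (hB : B ≠ 0) (hdet : B.det = 0) : B.rank = 1 := by
  have h0 : B.rank ≠ 0 := fun h => hB <| by
    rw [Matrix.rank, Submodule.finrank_eq_zero, LinearMap.range_eq_bot] at h
    exact Matrix.toLin'.injective (h.trans (map_zero Matrix.toLin').symm)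
  have h2 : B.rank ≠ 2 := fun h => by
    have hle : B.rank = Module.finrank K (Fin 2 → K) := by simp [h]
    rw [Matrix.rank] at hle
    have hsurj : Function.Surjective B.mulVec :=
      LinearMap.range_eq_top.mp (Submodule.eq_top_of_finrank_eq hle)
    have := (isUnit_iff_isUnit_det B).mp (mulVec_surjective_iff_isUnit.mp hsurj)
    exact not_isUnit_zero (hdet ▸ this)
  have := B.rank_le_card_width
  rw [Fintype.card_fin] at this
  omega

/-- The rank modulo a prime `p` is the number of diagonal entries of the Smith normal form that are
prime to `p`. -/
theorem IsSmithNormalForm.rank_map {p n : ℕ} [Fact p.Prime] {B : Matrix (Fin n) (Fin n) ℤ}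
    {a : Fin n → ℤ} (h : IsSmithNormalForm B a) :
    (B.map (Int.cast : ℤ → ZMod p)).rank =
      (Finset.univ.filter fun i => ¬ (p : ℤ) ∣ a i).card := by
  obtain ⟨⟨P, Q, hPQ⟩, -⟩ := h
  set f := (Int.castRingHom (ZMod p)).mapMatrix (m := Fin n)
  have hunit (R : GeneralLinearGroup (Fin n) ℤ) : IsUnit (f R).det :=
    (isUnit_iff_isUnit_det _).mp (R.isUnit.map f)
  have hmap : f P * B.map (Int.cast : ℤ → ZMod p) * f Q = diagonal fun i => (a i : ZMod p) := by
    have := congrArg f hPQ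
    rw [map_mul, map_mul] at this
    refine this.trans ?_
    simp [f, Matrix.diagonal_map]
  rw [← rank_mul_eq_right_of_isUnit_det (f P) _ (hunit P),
    ← rank_mul_eq_left_of_isUnit_det (f Q) _ (hunit Q), hmap, rank_diagonal, Fintype.card_subtype]
  simp only [ne_eq, ZMod.intCast_zmod_eq_zero_iff_dvd]

end Counting

theorem proposition3p1 (p : ℕ) (hp : p.Prime) (A : Matrix.SpecialLinearGroup (Fin 2) ℤ)
    (x : MappingTorus (torusHomeo A)) :
    ((A : Matrix (Fin 2) (Fin 2) ℤ).map (Int.cast : ℤ → ZMod p) = 1 →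
      untwistedDW (MappingTorus (torusHomeo A)) x (Multiplicative (ZMod p)) = (p : ℚ) ^ 2) ∧
    ((A : Matrix (Fin 2) (Fin 2) ℤ).map (Int.cast : ℤ → ZMod p) ≠ 1 →
      (A : Matrix (Fin 2) (Fin 2) ℤ).trace ≡ 2 [ZMOD p] →
      untwistedDW (MappingTorus (torusHomeo A)) x (Multiplicative (ZMod p)) = (p : ℚ)) ∧
    ((A : Matrix (Fin 2) (Fin 2) ℤ).map (Int.cast : ℤ → ZMod p) ≠ 1 →
      ¬ (A : Matrix (Fin 2) (Fin 2) ℤ).trace ≡ 2 [ZMOD p] →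
      untwistedDW (MappingTorus (torusHomeo A)) x (Multiplicative (ZMod p)) = 1) ∧
    (∀ a : Fin 2 → ℤ, IsSmithNormalForm ((A : Matrix (Fin 2) (Fin 2) ℤ) - 1) a →
      untwistedDW (MappingTorus (torusHomeo A)) x (Multiplicative (ZMod p)) =
        (p : ℚ) ^ (Finset.univ.filter (fun i => (p : ℤ) ∣ a i)).card) := by
  have : Fact p.Prime := ⟨hp⟩
  rw [untwistedDW_mappingTorus]
  refine ⟨fun h => ?_, fun h ht => ?_, fun h ht => ?_, fun a ha => ?_⟩
  · rw [subOneMod_eq_zero_iff.mpr h, Matrix.rank_zero]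
  · have hr : (subOneMod p A).rank = 1 := rank_eq_one_of_ne_zero_of_det_eq_zero
      (mt subOneMod_eq_zero_iff.mp h) (det_subOneMod_eq_zero_iff.mpr ht)
    rw [hr, pow_one]
  · have hr : (subOneMod p A).rank = Fintype.card (Fin 2) :=
      Matrix.rank_of_det_ne_zero (mt det_subOneMod_eq_zero_iff.mp ht)
    rw [hr, Fintype.card_fin, Nat.sub_self, pow_zero]
  · have hr : (subOneMod p A).rank = _ := ha.rank_map
    have := Finset.card_filter_add_card_filter_not (s := (Finset.univ : Finset (Fin 2)))
      (fun i => (p : ℤ) ∣ a i)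
    rw [Finset.card_fin] at this
    rw [hr]
    congr 1
    omega
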